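/- **Theorem.** Unknown bounded displacement eventual prefix consistency is solvable in an eventually synchronous message-passing system in which a majority of the processes is correct; and so is eventual strong prefix consistency, by the same protocol. Precisely: *System.* There are $n$ processes, fewer than $n/2$ of which are Byzantine; the others are correct. Time is counted in rounds $0,1,2,\dots$. In each round every correct process receives messages, may have an operation invoked at it, makes one step of a deterministic protocol, sends a message to each process, and may answer the operation in progress; processes are sequential. A message is a finite set of signed statements, each of which carries a tag and a finite list of blocks. Signatures are ideal: Byzantine processes send arbitrary messages, except that these contain no signature of a correct process that this process has not made. Messages are received in a later round than they are sent. There are a stabilisation time $GST$ and a bound $\Delta$ such that a message sent in round $t$ by a correct process to a correct process is received by round $\max(GST,t+\Delta)$. *Object.* The operations are $\mathsf{append}(b)$, for a block $b$, which returns $\top$ or $\bot$, and $\mathsf{read}()$, which returns a finite sequence of blocks (a chain). There are a genesis block $b_0$ and an arbitrary validity predicate $P$ on chains with $P(b_0)$. The history of an execution consists of the invocations and responses at correct processes; in addition a Byzantine process counts as invoking $\mathsf{append}(b)$ whenever it sends a message that carries $b$. A read $r$ *precedes* a read $r'$ if the response of $r$ comes before that of $r'$ in the order generated by the order of events at each process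 and by the order between a response and a strictly later invocation. Write $r/bc$ for a read $r$ (of a correct process) that returned $bc$, $bc[i]$ for the $i$-th block of $bc$ ($i\ge 0$; $\bot$ if there is none), and $|bc|$ for the number of blocks of $bc$. *Claim.* For all $n$, $b_0$ and $P$ there is a protocol such that for every set of fewer than $n/2$ Byzantine processes, all $GST$ and $\Delta$ (all unknown to the protocol) and every execution, every operation invoked at a correct process is answered, and the history satisfies: 1. *Chain validity*: every returned chain starts at $b_0$, has no repeated block, and satisfies $P$. 2. *Chain integrity*: for every block $b\ne b_0$ of a returned chain, $\mathsf{append}(b)$ was invoked before the response of the read. 3. *Eventual prefix*: if there are infinitely many reads, then for every read $r/bc$ and every $i$ with $bc[i]\ne\bot$ there is a read $r'/bc'$ such that $bc'[i]=bc''[i]$ for all reads $r''/bc''$ that $r'$ precedes. 4. *Ever growing tree*: if there are infinitely many reads and infinitely many appends at correct processes, then for every $k$ some read returns a chain with more than $k$ blocks, unless there is a chain $c$ which all but finitely many reads return while only finitely many append invocations at correct processes have a block $b\notin c$ with $P(c^\frown b)$. 5. *Bounded displacement*: there is $dis\in\mathbb N$ such that for all reads $r/bc$, $r'/bc'$ with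 $r$ preceding $r'$ one has $bc[i]=bc'[i]$ for all $i<|bc|-dis$. 6. *Eventual strong prefix*: if there are infinitely many reads, then there is a read $r$ such that for any two reads that $r$ precedes, one of the chains returned by them is a prefix of the other. Here 1–4 are eventual prefix consistency; 1–5 are unknown bounded displacement eventual prefix consistency; 1, 2, 4 and 6 are eventual strong prefix consistency. -/

import Mathlib

/-! ## Histories of a blocktree object

`n` processes, time counted in rounds `0, 1, 2, …`. A blockchain is a list of blocks, listed from
the genesis block on. -/

/-- The operations of the blocktree object. -/
inductive BTOp (Block : Type) where
  | append (b : Block)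
  | read

/-- The invocations and responses of operations. `append` returns a Boolean (`⊤` or `⊥`),
`read` returns a chain. -/
inductive BTLabel (Block : Type) where
  | appendInv (b : Block)
  | appendRsp (b : Block) (ok : Bool)
  | readInv
  | readRsp (bc : List Block)

def BTLabel.isInv {Block : Type} : BTLabel Block → Prop
  | .appendInv _ => True
  | .readInv => True
  | _ => False

def BTLabel.isRsp {Block : Type} : BTLabel Block → Prop
  | .appendRsp _ _ => True
  | .readRsp _ => True
  | _ => False

/-- The second label is a response to the operation invoked by the first one. -/
def BTLabel.Answers {Block : Type} : BTLabel Block → BTLabel Block → Prop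
  | .appendInv b, .appendRsp b' _ => b = b'
  | .readInv, .readRsp _ => True
  | _, _ => False

/-- The label of the invocation of an operation. -/
def BTOp.inv {Block : Type} : BTOp Block → BTLabel Block
  | .append b => .appendInv b
  | .read => .readInv

/-- An event: what happened, at which process, in which round. -/
structure BTEvent (n : ℕ) (Block : Type) where
  proc : Fin n
  time : ℕ
  label : BTLabel Block

/-- A concurrent history: its events, and which processes are correct. -/
structure BTHistory (n : ℕ) (Block : Type) where
  E : Set (BTEvent n Block)
  correct : Set (Fin n)

namespace BTHistory

variable {n : ℕ} {Block : Type}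

/-- Process order: same process, and the first event happens before the second one. (An operation
may be invoked and answered in the same round.) -/
def procOrder (e e' : BTEvent n Block) : Prop :=
  e.proc = e'.proc ∧
    (e.time < e'.time ∨ (e.time = e'.time ∧ e.label.isInv ∧ e'.label.isRsp))

/-- Operation order: a response that occurs strictly before an invocation. -/
def opOrder (e e' : BTEvent n Block) : Prop :=
  e.label.isRsp ∧ e'.label.isInv ∧ e.time < e'.time

/-- Program order: the order on the events generated by process order and operation order. -/
def progOrder (H : BTHistory n Block) : BTEvent n Block → BTEvent n Block → Prop :=
  Relation.TransGen fun e e' => e ∈ H.E ∧ e' ∈ H.E ∧ (procOrder e e' ∨ opOrder e e')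

/-- `e` is the response event of a `read` that returned `bc`. -/
def IsRead (H : BTHistory n Block) (e : BTEvent n Block) (bc : List Block) : Prop :=
  e ∈ H.E ∧ e.label = .readRsp bc

/-- `e` is the invocation event of an `append` of the block `b`. -/
def IsAppend (H : BTHistory n Block) (e : BTEvent n Block) (b : Block) : Prop :=
  e ∈ H.E ∧ e.label = .appendInv b

/-- Infinitely many reads. -/
def InfReads (H : BTHistory n Block) : Prop :=
  {e | ∃ bc, H.IsRead e bc}.Infinite

/-- Infinitely many appends invoked at correct processes. -/
def InfAppends (H : BTHistory n Block) : Prop :=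
  {e | e.proc ∈ H.correct ∧ ∃ b, H.IsAppend e b}.Infinite

/-- Every operation invoked at a correct process gets a response. -/
def Terminating (H : BTHistory n Block) : Prop :=
  ∀ e ∈ H.E, e.proc ∈ H.correct → e.label.isInv →
    ∃ e' ∈ H.E, procOrder e e' ∧ e.label.Answers e'.label

/-- Each returned sequence of blocks is a path without repetition that starts at the genesis
block `b₀`, and it is valid. -/
def ChainValidity (H : BTHistory n Block) (b₀ : Block) (P : List Block → Prop) : Prop :=
  ∀ r bc, H.IsRead r bc → bc.head? = some b₀ ∧ bc.Nodup ∧ P bc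

/-- Each returned block, except the genesis block, has been the argument of an `append` invoked
before the response of the `read`. -/
def ChainIntegrity (H : BTHistory n Block) (b₀ : Block) : Prop :=
  ∀ r bc, H.IsRead r bc → ∀ b ∈ bc, b ≠ b₀ → ∃ a, H.IsAppend a b ∧ a.time < r.time

/-- If there are infinitely many reads, then for each nonempty position `i` of a returned chain
there is a read such that all reads after it agree with it at position `i`. -/
def EventualPrefix (H : BTHistory n Block) : Prop :=
  H.InfReads → ∀ r bc, H.IsRead r bc → ∀ i : ℕ, bc[i]? ≠ none →
    ∃ r' bc', H.IsRead r' bc' ∧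
      ∀ r'' bc'', H.IsRead r'' bc'' → H.progOrder r' r'' → bc'[i]? = bc''[i]?

/-- The appends can go on: no chain which all but finitely many reads return is one that only
finitely many of the blocks appended at correct processes can validly extend. For a validity
predicate that accepts every chain, and blocks that are appended once each, this says no more than
that there are infinitely many appends. -/
def Extendable (H : BTHistory n Block) (P : List Block → Prop) : Prop :=
  ∀ c : List Block, {e | ∃ bc, H.IsRead e bc ∧ bc ≠ c}.Finite →
    {e | e.proc ∈ H.correct ∧ ∃ b, H.IsAppend e b ∧ b ∉ c ∧ P (c ++ [b])}.Infinite

/-- If there are infinitely many reads and infinitely many appends (that can go on), then returned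
chains are arbitrarily long. -/
def EverGrowingTree (H : BTHistory n Block) (P : List Block → Prop) : Prop :=
  H.InfReads → H.InfAppends → H.Extendable P →
    ∀ k : ℕ, ∃ r bc, H.IsRead r bc ∧ k < bc.length

/-- If there are infinitely many reads, then there is a read after which any two returned chains
are such that one is a prefix of the other. -/
def EventualStrongPrefix (H : BTHistory n Block) : Prop :=
  H.InfReads → ∃ r bc, H.IsRead r bc ∧
    ∀ r' bc' r'' bc'', H.IsRead r' bc' → H.IsRead r'' bc'' →
      H.progOrder r r' → H.progOrder r r'' → bc'' <+: bc' ∨ bc' <+: bc''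

/-- For some `dis`: if a read precedes another one, then the chain returned by the first, without
its last `dis` blocks, is a prefix of the chain returned by the second. -/
def BoundedDisplacement (H : BTHistory n Block) : Prop :=
  ∃ dis : ℕ, ∀ r bc r' bc', H.IsRead r bc → H.IsRead r' bc' → H.progOrder r r' →
    ∀ i : ℕ, i + dis < bc.length → bc[i]? = bc'[i]?

/-- The eventual prefix consistency criterion. -/
structure EP (H : BTHistory n Block) (b₀ : Block) (P : List Block → Prop) : Prop where
  chainValidity : H.ChainValidity b₀ P
  chainIntegrity : H.ChainIntegrity b₀
  eventualPrefix : H.EventualPrefix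
  everGrowingTree : H.EverGrowingTree P

/-- Unknown bounded displacement eventual prefix consistency. -/
structure UBDEP (H : BTHistory n Block) (b₀ : Block) (P : List Block → Prop) : Prop where
  ep : H.EP b₀ P
  boundedDisplacement : H.BoundedDisplacement

/-- The eventual strong prefix consistency criterion. -/
structure ESP (H : BTHistory n Block) (b₀ : Block) (P : List Block → Prop) : Prop where
  chainValidity : H.ChainValidity b₀ P
  chainIntegrity : H.ChainIntegrity b₀
  eventualStrongPrefix : H.EventualStrongPrefix
  everGrowingTree : H.EverGrowingTree P

end BTHistory

/-! ## Message passing with signatures, Byzantine processes and eventual synchrony -/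

/-- A signed statement: the signer, a tag from a set chosen by the protocol, and a list of blocks.
Signatures are ideal. A message is a finite set of signed statements. -/
structure SignedStmt (n : ℕ) (Tag Block : Type) where
  signer : Fin n
  tag : Tag
  blocks : List Block

/-- A deterministic protocol for `n` processes. In each round a process makes one step, from its
state, the operation that is invoked at it in this round (if any) and the signed statements that it
receives in this round. Its new state determines the message it sends to each process, and whether,
and how, the operation in progress (if any) is answered. -/
structure BTProtocol (n : ℕ) (Block : Type) where
  Tag : Type
  State : Type
  init : Fin n → State
  step : Fin n → State → Option (BTOp Block) → Set (SignedStmt n Tag Block) → State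
  send : Fin n → State → Fin n → Finset (SignedStmt n Tag Block)
  answerAppend : Fin n → State → Block → Option Bool
  answerRead : Fin n → State → Option (List Block)

/-- The answer, if any, to the operation in progress. -/
def BTProtocol.answer {n : ℕ} {Block : Type} (A : BTProtocol n Block) (p : Fin n) (s : A.State) :
    BTOp Block → Option (BTLabel Block)
  | .append b => (A.answerAppend p s b).map (BTLabel.appendRsp b)
  | .read => (A.answerRead p s).map BTLabel.readRsp

/-- The data of an execution.
* `state p t`: the state of `p` at the beginning of round `t`;
* `request p t`: the operation, if any, that the application at `p` wants to start in round `t`;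
* `sent p t q`: the message sent by `p` to `q` at the end of round `t` (empty: no message);
* `arrival p t q`: the round in which `q` receives that message. -/
structure BTExecution {n : ℕ} {Block : Type} (A : BTProtocol n Block) where
  state : Fin n → ℕ → A.State
  request : Fin n → ℕ → Option (BTOp Block)
  sent : Fin n → ℕ → Fin n → Finset (SignedStmt n A.Tag Block)
  arrival : Fin n → ℕ → Fin n → ℕ

namespace BTExecution

variable {n : ℕ} {Block : Type} {A : BTProtocol n Block}

/-- The operation of an earlier round that is still unanswered at the beginning of round `t`. -/
def busy (x : BTExecution A) (p : Fin n) : ℕ → Option (BTOp Block)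
  | 0 => none
  | t + 1 => ((x.busy p t).or (x.request p t)).filter
      fun o => (A.answer p (x.state p (t + 1)) o).isNone

/-- The operation in progress in round `t`. -/
def current (x : BTExecution A) (p : Fin n) (t : ℕ) : Option (BTOp Block) :=
  (x.busy p t).or (x.request p t)

/-- The operation invoked in round `t`; processes are sequential, so requests are only taken into
account while no earlier operation is in progress. -/
def invoked (x : BTExecution A) (p : Fin n) (t : ℕ) : Option (BTOp Block) :=
  if (x.busy p t).isNone then x.request p t else none

/-- The signed statements received by `q` in round `t`. -/
def received (x : BTExecution A) (q : Fin n) (t : ℕ) : Set (SignedStmt n A.Tag Block) :=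
  {m | ∃ p s, x.arrival p s q = t ∧ m ∈ x.sent p s q}

/-- `x` is an execution of the protocol in which the processes outside `byz` are correct, and which
is eventually synchronous with stabilisation time `GST` and message delay `Δ`. -/
structure IsRun (x : BTExecution A) (byz : Finset (Fin n)) (GST Δ : ℕ) : Prop where
  /-- Correct processes follow the protocol. -/
  init : ∀ p ∉ byz, x.state p 0 = A.init p
  step : ∀ p ∉ byz, ∀ t,
    x.state p (t + 1) = A.step p (x.state p t) (x.invoked p t) (x.received p t)
  /-- A process cannot make signatures of other processes; statements with a foreign signature that
  the sender has not received are therefore dropped from the messages of a correct process. -/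
  send : ∀ p ∉ byz, ∀ t q m, m ∈ x.sent p t q ↔
    m ∈ A.send p (x.state p (t + 1)) q ∧ (m.signer = p ∨ ∃ s ≤ t, m ∈ x.received p s)
  /-- Byzantine processes send anything, except for signatures of correct processes that these have
  not yet made. -/
  unforgeable : ∀ p ∈ byz, ∀ t q, ∀ m ∈ x.sent p t q, m.signer ∉ byz →
    ∃ s ≤ t, ∃ q', m ∈ x.sent m.signer s q'
  /-- Messages are received after they are sent. -/
  causal : ∀ p t q, t < x.arrival p t q
  /-- Eventual synchrony. -/
  synchrony : ∀ p ∉ byz, ∀ q ∉ byz, ∀ t, x.arrival p t q ≤ max GST (t + Δ)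

/-- The history of an execution. It contains the invocations and the responses at the correct
processes; moreover, a Byzantine process counts as invoking `append b` whenever it sends a message
that carries the block `b`. -/
def history (x : BTExecution A) (byz : Finset (Fin n)) : BTHistory n Block where
  E := {e |
    (e.proc ∉ byz ∧ ∃ o, x.invoked e.proc e.time = some o ∧ e.label = o.inv) ∨
    (e.proc ∉ byz ∧ ∃ o, x.current e.proc e.time = some o ∧
      A.answer e.proc (x.state e.proc (e.time + 1)) o = some e.label) ∨
    (e.proc ∈ byz ∧ ∃ b q, ∃ m ∈ x.sent e.proc e.time q, b ∈ m.blocks ∧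
      e.label = .appendInv b)}
  correct := {p | p ∉ byz}

end BTExecution

/-!
All criteria but chain validity and chain integrity concern the long run, so that agreement is only
needed from some round on; this is why a bare majority of correct processes suffices.

*Protocol* (`followLeader`). Every process keeps a log of its own, a valid chain to which it adds
blocks it has heard of, and signs and publishes it. All statements are forwarded to everybody in
each round, so that, whatever one correct process knows, all of them know `GST + Δ + 1` rounds later
(`seen_relay`). Every process follows the log of every process `ℓ` with a copy that grows by at most
one block per round, and counts the rounds for which that log has been unsatisfactory: `ℓ` has
signed incompatible versions of it, or the log offers no extension of the copy although a valid one
is pending. It signs the values of these counters. Epoch `e` has the process `e` modulo `n` as its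
leader, and is over when a majority has reported the count `e` for the leader. A read returns the
copy of the log of the leader of the first epoch that is not over, without delay.

*The leader becomes stable.* The log of a correct process is never unsatisfactory for more than
`2 * (GST + Δ + 1) + 2` rounds (`stall_le_of_correct`), and a majority includes a correct process;
so the late epochs of correct leaders are never over. Hence there is a first epoch that is never
over, and in the end all correct processes are in it. As the correct processes are a majority, not
all of them complain for that long about its leader `ℓ`, who may be Byzantine
(`exists_finalLeader`).

*The final leader is good enough.* If any correct process ever saw an equivocation of `ℓ`, all of
them would complain forever; so all copies of the log of `ℓ` are prefixes of each other
(`FinalLeader.prefix_or_prefix`), which yields the eventual strong prefix property. As copies grow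
by at most one block per round, one correct process is never ahead of another one by more than
`GST + Δ + 1` rounds (`FinalLeader.copy_prefix_copy_add`), even if `ℓ` reveals many blocks at once to
some processes only; together with the fact that the chains read before stabilisation have bounded
length, this bounds the displacement. If the copies stopped growing although a valid block is
pending, all correct processes would complain forever
(`FinalLeader.not_canGrow_of_eventually_eq`); so the tree is ever growing.
-/

/-! ### Growing a chain -/

/-- Some block of `S` is new to the chain `c` and extends it to a valid chain. -/
def CanGrow {Block : Type} (P : List Block → Prop) (c : List Block) (S : Set Block) : Prop :=
  ∃ b ∈ S, b ∉ c ∧ P (c ++ [b])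

open Classical in
/-- Extend `c` by one suitable block of `S`, if there is one. -/
noncomputable def grow {Block : Type} (P : List Block → Prop) (c : List Block) (S : Set Block) :
    List Block :=
  if h : CanGrow P c S then c ++ [h.choose] else c

/-- The chains that arise from the genesis block by adding new blocks one by one, such that each
intermediate chain is valid. -/
inductive Grown {Block : Type} (b₀ : Block) (P : List Block → Prop) : List Block → Prop
  | genesis : Grown b₀ P [b₀]
  | snoc {c : List Block} {b : Block} (hc : Grown b₀ P c) (hb : b ∉ c) (h : P (c ++ [b])) :
      Grown b₀ P (c ++ [b])

section Grow

variable {Block : Type} {b₀ : Block} {P : List Block → Prop} {c d : List Block} {S T : Set Block}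

theorem CanGrow.mono (h : CanGrow P c S) (hST : S ⊆ T) : CanGrow P c T := by
  obtain ⟨b, hb, h⟩ := h
  exact ⟨b, hST hb, h⟩

theorem grow_of_not_canGrow (h : ¬ CanGrow P c S) : grow P c S = c := by
  simp [grow, h]

theorem CanGrow.exists_grow_eq (h : CanGrow P c S) :
    ∃ b ∈ S, b ∉ c ∧ P (c ++ [b]) ∧ grow P c S = c ++ [b] :=
  ⟨h.choose, h.choose_spec.1, h.choose_spec.2.1, h.choose_spec.2.2, by simp [grow, h]⟩

theorem prefix_grow : c <+: grow P c S := by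
  by_cases h : CanGrow P c S
  · obtain ⟨b, -, -, -, e⟩ := h.exists_grow_eq
    rw [e]
    exact List.prefix_append _ _
  · rw [grow_of_not_canGrow h]

theorem length_grow_le : (grow P c S).length ≤ c.length + 1 := by
  by_cases h : CanGrow P c S
  · obtain ⟨b, -, -, -, e⟩ := h.exists_grow_eq
    simp [e]
  · simp [grow_of_not_canGrow h]

theorem Grown.grow (h : Grown b₀ P c) : Grown b₀ P (grow P c S) := by
  by_cases hS : CanGrow P c S
  · obtain ⟨b, -, h1, h2, e⟩ := hS.exists_grow_eq
    rw [e]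
    exact h.snoc h1 h2
  · rwa [grow_of_not_canGrow hS]

theorem Grown.genesis_prefix (h : Grown b₀ P c) : [b₀] <+: c := by
  induction h with
  | genesis => exact List.prefix_rfl
  | snoc _ _ _ ih => exact ih.trans (List.prefix_append _ _)

theorem Grown.head?_eq (h : Grown b₀ P c) : c.head? = some b₀ := by
  obtain ⟨l, rfl⟩ := h.genesis_prefix
  rfl

theorem Grown.ne_nil (h : Grown b₀ P c) : c ≠ [] := by
  rintro rfl
  simpa using h.head?_eq

theorem Grown.nodup (h : Grown b₀ P c) : c.Nodup := by
  induction h with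
  | genesis => simp
  | snoc _ hb _ ih => simpa [List.nodup_append] using ⟨ih, fun a ha e => hb (e ▸ ha)⟩

theorem Grown.valid (hP : P [b₀]) (h : Grown b₀ P c) : P c := by
  cases h with
  | genesis => exact hP
  | snoc _ _ h => exact h

theorem Grown.of_concat_prefix (h : Grown b₀ P c) {b : Block} (hd : d ≠ [])
    (hp : d ++ [b] <+: c) : b ∉ d ∧ P (d ++ [b]) := by
  induction h with
  | genesis =>
    have h1 := hp.length_le
    have h2 := List.length_pos_iff.2 hd
    rw [List.length_append, List.length_singleton, List.length_singleton] at h1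
    omega
  | snoc _ hb h ih =>
    rcases List.prefix_concat_iff.1 hp with e | hp
    · obtain ⟨rfl, e⟩ := List.append_inj' e rfl
      obtain rfl : b = _ := by simpa using e
      exact ⟨hb, h⟩
    · exact ih hp

end Grow

/-! ### The protocol -/

/-- The kinds of signed statements: "this is my log", "this block was appended at my site", and
"the log of `ℓ` has been unsatisfactory for the last `k` rounds". -/
inductive StmtKind (n : ℕ) where
  | log
  | appended
  | stalled (ℓ : Fin n) (k : ℕ)

/-- The signed statements of the protocol. -/
abbrev Stmt (n : ℕ) (Block : Type) := SignedStmt n (StmtKind n) Block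

/-- The state of a process: the statements it has seen (received or made), its own log, its copies
of the logs of all the processes, and for each process the number of rounds for which the log of
that process has been unsatisfactory. -/
structure LocalState (n : ℕ) (Block : Type) where
  seen : Finset (Stmt n Block)
  log : List Block
  copy : Fin n → List Block
  stall : Fin n → ℕ

section Protocol

variable {n : ℕ} {Block : Type}

/-- The blocks that occur in the statements of `S`. -/
def carried (S : Finset (Stmt n Block)) : Set Block :=
  {b | ∃ m ∈ S, b ∈ m.blocks}

/-- The statement `m` is a version of the log of `ℓ`. -/
def IsLogOf (m : Stmt n Block) (ℓ : Fin n) : Prop :=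
  m.signer = ℓ ∧ m.tag = .log

/-- The blocks that come right after `c` in a version of the log of `ℓ`. -/
def nextInLog (S : Finset (Stmt n Block)) (ℓ : Fin n) (c : List Block) : Set Block :=
  {b | ∃ m ∈ S, IsLogOf m ℓ ∧ c ++ [b] <+: m.blocks}

/-- According to `S`, process `ℓ` has signed two versions of its log neither of which extends the
other. -/
def Equivocates (S : Finset (Stmt n Block)) (ℓ : Fin n) : Prop :=
  ∃ m ∈ S, ∃ m' ∈ S, IsLogOf m ℓ ∧ IsLogOf m' ℓ ∧
    ¬ m.blocks <+: m'.blocks ∧ ¬ m'.blocks <+: m.blocks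

/-- The log of `ℓ` is unsatisfactory: `ℓ` equivocates, or its log offers no extension of the copy
although some known block would be a valid one. -/
def Unsatisfactory (P : List Block → Prop) (s : LocalState n Block) (ℓ : Fin n) : Prop :=
  Equivocates s.seen ℓ ∨
    (¬ CanGrow P (s.copy ℓ) (nextInLog s.seen ℓ (s.copy ℓ)) ∧
      CanGrow P (s.copy ℓ) (carried s.seen))

open Classical in
/-- The statements that `p` makes in a round. -/
noncomputable def ownStmts (p : Fin n) (s : LocalState n Block) (o : Option (BTOp Block)) :
    Finset (Stmt n Block) :=
  {⟨p, .log, s.log⟩} ∪ Finset.univ.image (fun ℓ => ⟨p, .stalled ℓ (s.stall ℓ), []⟩) ∪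
    match o with
    | some (.append b) => {⟨p, .appended, [b]⟩}
    | _ => ∅

theorem mem_ownStmts {p : Fin n} {s : LocalState n Block} {o : Option (BTOp Block)}
    {m : Stmt n Block} :
    m ∈ ownStmts p s o ↔ m = ⟨p, .log, s.log⟩ ∨ (∃ ℓ, m = ⟨p, .stalled ℓ (s.stall ℓ), []⟩) ∨
      ∃ b, o = some (.append b) ∧ m = ⟨p, .appended, [b]⟩ := by
  rcases o with _ | _ | _ <;> simp [ownStmts, eq_comm, or_comm (b := ∃ _, _)]

theorem Equivocates.mono {S T : Finset (Stmt n Block)} {ℓ : Fin n} (h : Equivocates S ℓ)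
    (hST : S ⊆ T) : Equivocates T ℓ := by
  obtain ⟨m, hm, m', hm', h⟩ := h
  exact ⟨m, hST hm, m', hST hm', h⟩

theorem carried_mono {S T : Finset (Stmt n Block)} (hST : S ⊆ T) : carried S ⊆ carried T :=
  fun _ ⟨m, hm, hb⟩ => ⟨m, hST hm, hb⟩

variable [NeZero n]

/-- Epoch `e` is over when a majority has complained for `e` rounds about its leader, the process
number `e` modulo `n`. -/
def EpochOver (S : Finset (Stmt n Block)) (e : ℕ) : Prop :=
  n < 2 * {q : Fin n | (⟨q, .stalled (Fin.ofNat n e) e, []⟩ : Stmt n Block) ∈ S}.ncard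

open Classical in
/-- The first epoch that is not over (`0`, irrelevantly, if there were none). -/
noncomputable def epoch (S : Finset (Stmt n Block)) : ℕ :=
  if h : ∃ e, ¬ EpochOver S e then Nat.find h else 0

/-- The chain returned by a read: the copy of the log of the leader of the current epoch. -/
noncomputable def LocalState.shown (s : LocalState n Block) : List Block :=
  s.copy (Fin.ofNat n (epoch s.seen))

open Classical in
/-- The protocol. Every process keeps a log of its own, to which it adds at most one block per
round; follows the logs of all processes, at the speed of at most one block per round; counts for
how long each log has been unsatisfactory; and sends all it has seen to all processes. All
operations are answered at once. Logs and copies grow on the basis of what was seen in earlier rounds,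
so that the blocks returned by a read were appended strictly before its response. In executions the
set `R` of statements received in a round is finite (`received_finite`). -/
noncomputable def followLeader (b₀ : Block) (P : List Block → Prop) (n : ℕ) [NeZero n] :
    BTProtocol n Block where
  Tag := StmtKind n
  State := LocalState n Block
  init _ := ⟨∅, [b₀], fun _ => [b₀], fun _ => 0⟩
  step p s o R :=
    { seen := s.seen ∪ (if h : R.Finite then h.toFinset else ∅) ∪ ownStmts p s o
      log := grow P s.log (carried s.seen)
      copy := fun ℓ => grow P (s.copy ℓ) (nextInLog s.seen ℓ (s.copy ℓ))
      stall := fun ℓ => if Unsatisfactory P s ℓ then s.stall ℓ + 1 else 0 }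
  send _ s _ := s.seen
  answerAppend _ _ _ := some true
  answerRead _ s := some s.shown

theorem mem_seen_step {b₀ : Block} {P : List Block → Prop} {p : Fin n} {s : LocalState n Block}
    {o : Option (BTOp Block)} {R : Set (Stmt n Block)} (hR : R.Finite) {m : Stmt n Block} :
    m ∈ LocalState.seen ((followLeader b₀ P n).step p s o R) ↔
      m ∈ s.seen ∨ m ∈ R ∨ m ∈ ownStmts p s o := by
  simp [followLeader, hR]

theorem EpochOver.mono {S T : Finset (Stmt n Block)} {e : ℕ} (h : EpochOver S e) (hST : S ⊆ T) :
    EpochOver T e :=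
  h.trans_le (Nat.mul_le_mul_left 2 (Set.ncard_le_ncard (fun _ hq => hST hq) (Set.toFinite _)))

open Classical in
theorem epoch_eq {S : Finset (Stmt n Block)} {e : ℕ} (he : ¬ EpochOver S e)
    (hlt : ∀ e' < e, EpochOver S e') : epoch S = e := by
  have h : ∃ e, ¬ EpochOver S e := ⟨e, he⟩
  rw [epoch, dif_pos h, Nat.find_eq_iff]
  exact ⟨he, fun e' h' => not_not.2 (hlt e' h')⟩

end Protocol

/-! ### Correct processes and program order -/

theorem exists_correct {n : ℕ} {byz : Finset (Fin n)} (hbyz : 2 * byz.card < n) : ∃ p, p ∉ byz := by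
  by_contra! h
  have : byz = Finset.univ := Finset.eq_univ_iff_forall.2 h
  rw [this, Finset.card_univ, Fintype.card_fin] at hbyz
  omega

theorem time_le_of_progOrder {n : ℕ} {Block : Type} {H : BTHistory n Block} {e e' : BTEvent n Block}
    (h : H.progOrder e e') : e.time ≤ e'.time := by
  have step : ∀ {a b : BTEvent n Block},
      a ∈ H.E ∧ b ∈ H.E ∧ (BTHistory.procOrder a b ∨ BTHistory.opOrder a b) →
        a.time ≤ b.time := by
    rintro a b ⟨-, -, ⟨-, h | h⟩ | h⟩
    · exact h.le
    · exact h.1.le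
    · exact h.2.2.le
  induction h with
  | single h => exact step h
  | tail _ h ih => exact ih.trans (step h)

/-! ### What a process knows in the course of an execution -/

section Run

variable {n : ℕ} {Block : Type} [NeZero n] {b₀ : Block} {P : List Block → Prop}

/-- The state of `p` at the beginning of round `t`. -/
def stateAt (x : BTExecution (followLeader b₀ P n)) (p : Fin n) (t : ℕ) : LocalState n Block :=
  x.state p t

variable {x : BTExecution (followLeader b₀ P n)} {byz : Finset (Fin n)} {GST Δ : ℕ}
  {p q ℓ : Fin n} {t t' : ℕ}

theorem received_finite (hx : x.IsRun byz GST Δ) (q : Fin n) (t : ℕ) :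
    (x.received q t).Finite := by
  have : x.received q t ⊆
      ⋃ p : Fin n, ⋃ s ∈ Set.Iio t, (x.sent p s q : Set (SignedStmt n _ Block)) := by
    rintro m ⟨p, s, rfl, hm⟩
    simp only [Set.mem_iUnion]
    exact ⟨p, s, hx.causal p s q, hm⟩
  exact (Set.finite_iUnion fun p => (Set.finite_Iio t).biUnion fun s _ =>
    Finset.finite_toSet _).subset this

theorem stateAt_zero (hx : x.IsRun byz GST Δ) (hp : p ∉ byz) :
    stateAt x p 0 = ⟨∅, [b₀], fun _ => [b₀], fun _ => 0⟩ :=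
  hx.init p hp

theorem mem_seen_succ (hx : x.IsRun byz GST Δ) (hp : p ∉ byz) {m : Stmt n Block} :
    m ∈ (stateAt x p (t + 1)).seen ↔ m ∈ (stateAt x p t).seen ∨ m ∈ x.received p t ∨
      m ∈ ownStmts p (stateAt x p t) (x.invoked p t) := by
  have h : stateAt x p (t + 1) = _ := hx.step p hp t
  rw [h]
  exact mem_seen_step (received_finite hx p t)

theorem log_succ (hx : x.IsRun byz GST Δ) (hp : p ∉ byz) :
    (stateAt x p (t + 1)).log = grow P (stateAt x p t).log (carried (stateAt x p t).seen) := by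
  have h : stateAt x p (t + 1) = _ := hx.step p hp t
  rw [h]
  rfl

theorem copy_succ (hx : x.IsRun byz GST Δ) (hp : p ∉ byz) :
    (stateAt x p (t + 1)).copy ℓ = grow P ((stateAt x p t).copy ℓ)
      (nextInLog (stateAt x p t).seen ℓ ((stateAt x p t).copy ℓ)) := by
  have h : stateAt x p (t + 1) = _ := hx.step p hp t
  rw [h]
  rfl

open Classical in
theorem stall_succ (hx : x.IsRun byz GST Δ) (hp : p ∉ byz) :
    (stateAt x p (t + 1)).stall ℓ =
      if Unsatisfactory P (stateAt x p t) ℓ then (stateAt x p t).stall ℓ + 1 else 0 := by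
  have h : stateAt x p (t + 1) = _ := hx.step p hp t
  rw [h]
  rfl

theorem seen_mono (hx : x.IsRun byz GST Δ) (hp : p ∉ byz) :
    Monotone fun t => (stateAt x p t).seen :=
  monotone_nat_of_le_succ fun _ _ hm => (mem_seen_succ hx hp).2 (.inl hm)

theorem log_mono (hx : x.IsRun byz GST Δ) (hp : p ∉ byz) (h : t ≤ t') :
    (stateAt x p t).log <+: (stateAt x p t').log := by
  induction h with
  | refl => exact List.prefix_rfl
  | step _ ih => exact ih.trans (log_succ hx hp ▸ prefix_grow)

theorem copy_mono (hx : x.IsRun byz GST Δ) (hp : p ∉ byz) (h : t ≤ t') :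
    (stateAt x p t).copy ℓ <+: (stateAt x p t').copy ℓ := by
  induction h with
  | refl => exact List.prefix_rfl
  | step _ ih => exact ih.trans (copy_succ hx hp ▸ prefix_grow)

theorem log_grown (hx : x.IsRun byz GST Δ) (hp : p ∉ byz) (t : ℕ) :
    Grown b₀ P (stateAt x p t).log := by
  induction t with
  | zero => rw [stateAt_zero hx hp]; exact .genesis
  | succ t ih => rw [log_succ hx hp]; exact ih.grow

theorem copy_grown (hx : x.IsRun byz GST Δ) (hp : p ∉ byz) (t : ℕ) :
    Grown b₀ P ((stateAt x p t).copy ℓ) := by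
  induction t with
  | zero => rw [stateAt_zero hx hp]; exact .genesis
  | succ t ih => rw [copy_succ hx hp]; exact ih.grow

theorem length_copy_add_le (hx : x.IsRun byz GST Δ) (hp : p ∉ byz) (t d : ℕ) :
    ((stateAt x p (t + d)).copy ℓ).length ≤ ((stateAt x p t).copy ℓ).length + d := by
  induction d with
  | zero => rfl
  | succ d ih =>
    rw [← add_assoc, copy_succ hx hp]
    exact length_grow_le.trans (by omega)

theorem length_copy_le (hx : x.IsRun byz GST Δ) (hp : p ∉ byz) (t : ℕ) :
    ((stateAt x p t).copy ℓ).length ≤ t + 1 := by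
  have h := length_copy_add_le (ℓ := ℓ) hx hp 0 t
  rw [zero_add, stateAt_zero hx hp] at h
  simpa [add_comm] using h

/-- A copy consists of the genesis block only, or it is part of a version of the log seen before. -/
theorem copy_eq_or_prefix (hx : x.IsRun byz GST Δ) (hp : p ∉ byz) (t : ℕ) :
    (stateAt x p t).copy ℓ = [b₀] ∨ ∃ s < t, ∃ m ∈ (stateAt x p s).seen, IsLogOf m ℓ ∧
      (stateAt x p t).copy ℓ <+: m.blocks := by
  induction t with
  | zero => left; rw [stateAt_zero hx hp]
  | succ t ih =>
    rw [copy_succ hx hp]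
    by_cases h : CanGrow P ((stateAt x p t).copy ℓ)
      (nextInLog (stateAt x p t).seen ℓ ((stateAt x p t).copy ℓ))
    · obtain ⟨b, ⟨m, hm, hl, hpre⟩, -, -, e⟩ := h.exists_grow_eq
      exact .inr ⟨t, t.lt_succ_self, m, hm, hl, e ▸ hpre⟩
    · rw [grow_of_not_canGrow h]
      exact ih.imp_right fun ⟨s, hs, h⟩ => ⟨s, by omega, h⟩

theorem seen_of_sent (hx : x.IsRun byz GST Δ) (hp : p ∉ byz) {m : Stmt n Block}
    (hm : m ∈ x.sent p t q) : m ∈ (stateAt x p (t + 1)).seen :=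
  ((hx.send p hp t q m).1 hm).1

theorem signer_eq_or_received (hx : x.IsRun byz GST Δ) (hp : p ∉ byz) {m : Stmt n Block}
    (hm : m ∈ (stateAt x p t).seen) : m.signer = p ∨ ∃ s ≤ t, m ∈ x.received p s := by
  induction t with
  | zero => rw [stateAt_zero hx hp] at hm; simp at hm
  | succ t ih =>
    rcases (mem_seen_succ hx hp).1 hm with h | h | h
    · exact (ih h).imp_right fun ⟨s, hs, h⟩ => ⟨s, by omega, h⟩
    · exact .inr ⟨t, by omega, h⟩
    · rcases mem_ownStmts.1 h with rfl | ⟨_, rfl⟩ | ⟨_, _, rfl⟩ <;> exact .inl rfl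

/-- Since processes forward all they have seen, `GST + Δ + 1` rounds suffice for a statement to
get from one correct process to another, also before the stabilisation time. -/
theorem seen_relay (hx : x.IsRun byz GST Δ) (hp : p ∉ byz) (hq : q ∉ byz)
    (h : t + (GST + Δ + 1) ≤ t') : (stateAt x p t).seen ⊆ (stateAt x q t').seen := by
  intro m hm
  have hs : m ∈ x.sent p t q := (hx.send p hp t q m).2
    ⟨seen_mono hx hp t.le_succ hm, signer_eq_or_received hx hp hm⟩
  have ha := hx.synchrony p hp q hq t
  have hr : m ∈ x.received q (x.arrival p t q) := ⟨p, t, rfl, hs⟩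
  exact seen_mono hx hq (show x.arrival p t q + 1 ≤ t' by omega)
    ((mem_seen_succ hx hq).2 (.inr (.inl hr)))

/-- Statements with the signature of a correct process have been made by it. -/
theorem made_of_seen (hx : x.IsRun byz GST Δ) (hq : q ∉ byz) {m : Stmt n Block}
    (hm : m ∈ (stateAt x q t).seen) (hs : m.signer ∉ byz) :
    ∃ s < t, m ∈ ownStmts m.signer (stateAt x m.signer s) (x.invoked m.signer s) := by
  induction t using Nat.strong_induction_on generalizing q with
  | _ t ih =>
    cases t with
    | zero => rw [stateAt_zero hx hq] at hm; simp at hm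
    | succ t =>
      rcases (mem_seen_succ hx hq).1 hm with h | ⟨r, s, hst, h⟩ | h
      · obtain ⟨s, hs, h⟩ := ih t t.lt_succ_self hq h
        exact ⟨s, by omega, h⟩
      · have hlt := hx.causal r s q
        by_cases hr : r ∈ byz
        · obtain ⟨s', hs', q', h⟩ := hx.unforgeable r hr s q m h hs
          obtain ⟨u, hu, h⟩ := ih (s' + 1) (by omega) hs (seen_of_sent hx hs h)
          exact ⟨u, by omega, h⟩
        · obtain ⟨u, hu, h⟩ := ih (s + 1) (by omega) hr (seen_of_sent hx hr h)
          exact ⟨u, by omega, h⟩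
      · have e : m.signer = q := by
          rcases mem_ownStmts.1 h with rfl | ⟨_, rfl⟩ | ⟨_, _, rfl⟩ <;> rfl
        exact ⟨t, t.lt_succ_self, e ▸ h⟩

theorem exists_log_eq_of_seen (hx : x.IsRun byz GST Δ) (hq : q ∉ byz) (hℓ : ℓ ∉ byz)
    {m : Stmt n Block} (hm : m ∈ (stateAt x q t).seen) (hl : IsLogOf m ℓ) :
    ∃ s < t, m.blocks = (stateAt x ℓ s).log := by
  obtain ⟨rfl, hl⟩ := hl
  obtain ⟨s, hs, h⟩ := made_of_seen hx hq hm hℓ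
  rcases mem_ownStmts.1 h with h | ⟨_, h⟩ | ⟨_, _, h⟩
  · exact ⟨s, hs, by rw [h]⟩
  all_goals rw [h] at hl; cases hl

theorem exists_stall_eq_of_seen (hx : x.IsRun byz GST Δ) (hp : p ∉ byz) (hq : q ∉ byz) {k : ℕ}
    (hm : (⟨q, .stalled ℓ k, []⟩ : Stmt n Block) ∈ (stateAt x p t).seen) :
    ∃ s, (stateAt x q s).stall ℓ = k := by
  obtain ⟨s, -, h⟩ := made_of_seen hx hp hm hq
  rcases mem_ownStmts.1 h with h | ⟨_, h⟩ | ⟨_, _, h⟩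
  · cases h
  · rw [SignedStmt.mk.injEq, StmtKind.stalled.injEq] at h
    obtain ⟨-, ⟨rfl, hk⟩, -⟩ := h
    exact ⟨s, hk.symm⟩
  · cases h

/-! ### A correct process is a good leader -/

theorem copy_prefix_log (hx : x.IsRun byz GST Δ) (hp : p ∉ byz) (hℓ : ℓ ∉ byz) (t : ℕ) :
    (stateAt x p t).copy ℓ <+: (stateAt x ℓ t).log := by
  rcases copy_eq_or_prefix (ℓ := ℓ) hx hp t with h | ⟨s, hs, m, hm, hl, h⟩
  · exact h ▸ (log_grown hx hℓ t).genesis_prefix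
  · obtain ⟨u, hu, e⟩ := exists_log_eq_of_seen hx hp hℓ hm hl
    exact h.trans (e ▸ log_mono hx hℓ (by omega))

theorem not_equivocates_of_correct (hx : x.IsRun byz GST Δ) (hp : p ∉ byz) (hℓ : ℓ ∉ byz) (t : ℕ) :
    ¬ Equivocates (stateAt x p t).seen ℓ := by
  rintro ⟨m, hm, m', hm', hl, hl', h, h'⟩
  obtain ⟨s, -, e⟩ := exists_log_eq_of_seen hx hp hℓ hm hl
  obtain ⟨s', -, e'⟩ := exists_log_eq_of_seen hx hp hℓ hm' hl'
  rw [e, e'] at h h'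
  rcases le_total s s' with hs | hs
  · exact h (log_mono hx hℓ hs)
  · exact h' (log_mono hx hℓ hs)

/-- What a positive counter stands for, as long as there is no equivocation. -/
theorem exists_start_of_stall (hx : x.IsRun byz GST Δ) (hp : p ∉ byz)
    (hne : ∀ t, ¬ Equivocates (stateAt x p t).seen ℓ) (t : ℕ) :
    ∃ s, s + (stateAt x p t).stall ℓ = t ∧
      (stateAt x p s).copy ℓ = (stateAt x p t).copy ℓ ∧
      (0 < (stateAt x p t).stall ℓ →
        CanGrow P ((stateAt x p t).copy ℓ) (carried (stateAt x p s).seen)) := by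
  induction t with
  | zero => rw [stateAt_zero hx hp]; exact ⟨0, by simp [stateAt_zero hx hp]⟩
  | succ t ih =>
    obtain ⟨s, hst, hc, hg⟩ := ih
    rw [stall_succ hx hp]
    split_ifs with hu
    · obtain ⟨h, h'⟩ := hu.resolve_left (hne t)
      rw [copy_succ hx hp, grow_of_not_canGrow h]
      refine ⟨s, by omega, hc, fun _ => ?_⟩
      rcases Nat.eq_zero_or_pos ((stateAt x p t).stall ℓ) with h0 | h0
      · obtain rfl : s = t := by omega
        exact h'
      · exact hg h0
    · exact ⟨t + 1, rfl, rfl, fun h => absurd h (lt_irrefl 0)⟩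

/-- A correct process is not complained about for long: a pending block reaches it, it extends its
log, and the extension comes back, all within bounded time. -/
theorem stall_le_of_correct (hx : x.IsRun byz GST Δ) (hp : p ∉ byz) (hℓ : ℓ ∉ byz) (t : ℕ) :
    (stateAt x p t).stall ℓ ≤ 2 * (GST + Δ + 1) + 2 := by
  by_contra! hlt
  obtain ⟨s, hst, hc, hg⟩ :=
    exists_start_of_stall hx hp (not_equivocates_of_correct hx hp hℓ) t
  generalize (stateAt x p t).stall ℓ = k at *
  generalize hD : GST + Δ + 1 = D at *
  have hconst : ∀ u, s ≤ u → u ≤ t → (stateAt x p u).copy ℓ = (stateAt x p s).copy ℓ :=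
    fun u h1 h2 => ((hc ▸ copy_mono hx hp h2 :
      (stateAt x p u).copy ℓ <+: (stateAt x p s).copy ℓ).eq_of_length_le
        (copy_mono hx hp h1).length_le)
  replace hg := hg (by omega)
  rw [← hc] at hg
  set c := (stateAt x p s).copy ℓ with hcdef
  obtain ⟨b, hb⟩ : ∃ b, c ++ [b] <+: (stateAt x ℓ (s + D + 1)).log := by
    have hpre : c <+: (stateAt x ℓ (s + D)).log :=
      hconst (s + D) (by omega) (by omega) ▸ copy_prefix_log hx hp hℓ (s + D)
    obtain ⟨r, hr⟩ := hpre
    rcases r with _ | ⟨b, r⟩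
    · rw [List.append_nil] at hr
      have hg' : CanGrow P c (carried (stateAt x ℓ (s + D)).seen) :=
        hg.mono (carried_mono (seen_relay hx hp hℓ (by omega)))
      rw [log_succ hx hℓ, ← hr]
      obtain ⟨b, -, -, -, e⟩ := hg'.exists_grow_eq
      exact ⟨b, e ▸ List.prefix_rfl⟩
    · refine ⟨b, List.IsPrefix.trans ⟨r, ?_⟩ (log_mono hx hℓ (Nat.le_succ _))⟩
      simpa using hr
  have hm : (⟨ℓ, .log, (stateAt x ℓ (s + D + 1)).log⟩ : Stmt n Block) ∈
      (stateAt x p (s + 2 * D + 2)).seen :=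
    seen_relay hx hℓ hp (t := s + D + 1 + 1) (by omega)
      ((mem_seen_succ hx hℓ).2 (.inr (.inr (mem_ownStmts.2 (.inl rfl)))))
  have e := copy_succ (ℓ := ℓ) (t := s + 2 * D + 2) hx hp
  rw [hconst _ (by omega) (by omega), hconst _ (by omega) (by omega)] at e
  have hcan : CanGrow P c (nextInLog (stateAt x p (s + 2 * D + 2)).seen ℓ c) :=
    ⟨b, ⟨_, hm, ⟨rfl, rfl⟩, hb⟩,
      (log_grown hx hℓ _).of_concat_prefix (copy_grown hx hp s).ne_nil hb⟩
  obtain ⟨b', -, -, -, e'⟩ := hcan.exists_grow_eq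
  rw [e'] at e
  simpa using congrArg List.length e

/-! ### The final epoch -/

theorem EpochOver.exists_stall_eq (hbyz : 2 * byz.card < n) (hx : x.IsRun byz GST Δ)
    (hp : p ∉ byz) {e : ℕ} (h : EpochOver (stateAt x p t).seen e) :
    ∃ q ∉ byz, ∃ s, (stateAt x q s).stall (Fin.ofNat n e) = e := by
  by_contra! hne
  have hsub : {q : Fin n | (⟨q, .stalled (Fin.ofNat n e) e, []⟩ : Stmt n Block) ∈
      (stateAt x p t).seen} ⊆ (byz : Set (Fin n)) := by
    intro q hq
    by_contra hqb
    obtain ⟨s, hs⟩ := exists_stall_eq_of_seen hx hp hqb hq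
    exact hne q hqb s hs
  have := Set.ncard_le_ncard hsub (Set.toFinite _)
  rw [Set.ncard_coe_finset] at this
  unfold EpochOver at h
  omega

theorem exists_stall_eq_of_le (hx : x.IsRun byz GST Δ) (hp : p ∉ byz) {k : ℕ}
    (h : k ≤ (stateAt x p t).stall ℓ) : ∃ s, (stateAt x p s).stall ℓ = k := by
  induction t with
  | zero =>
    have h0 : (stateAt x p 0).stall ℓ = 0 := by rw [stateAt_zero hx hp]
    exact ⟨0, by omega⟩
  | succ t ih =>
    by_cases hk : k ≤ (stateAt x p t).stall ℓ
    · exact ih hk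
    · refine ⟨t + 1, le_antisymm ?_ h⟩
      rw [stall_succ hx hp]
      split_ifs <;> omega

theorem exists_le_stall_of_unsatisfactory (hx : x.IsRun byz GST Δ) (hp : p ∉ byz) {T : ℕ}
    (h : ∀ t, T ≤ t → Unsatisfactory P (stateAt x p t) ℓ) (k : ℕ) :
    k ≤ (stateAt x p (T + k)).stall ℓ := by
  induction k with
  | zero => exact Nat.zero_le _
  | succ k ih =>
    rw [← add_assoc, stall_succ hx hp, if_pos (h _ (by omega))]
    omega

/-- From round `T` on, all correct processes are in an epoch with leader `ℓ`, and some correct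
process `p` never complains that `ℓ` has been unsatisfactory for `k` rounds. -/
structure FinalLeader (x : BTExecution (followLeader b₀ P n)) (byz : Finset (Fin n)) (T : ℕ)
    (ℓ : Fin n) (k : ℕ) : Prop where
  shown : ∀ p ∉ byz, ∀ t, T ≤ t → (stateAt x p t).shown = (stateAt x p t).copy ℓ
  content : ∃ p ∉ byz, ∀ t, (stateAt x p t).stall ℓ < k

theorem exists_finalLeader (hbyz : 2 * byz.card < n) (hx : x.IsRun byz GST Δ) :
    ∃ T ℓ k, FinalLeader x byz T ℓ k := by
  classical
  have hex : ∃ e, ∀ q ∉ byz, ∀ t, ¬ EpochOver (stateAt x q t).seen e := by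
    obtain ⟨ℓ, hℓ⟩ := exists_correct hbyz
    -- A late enough epoch of which `ℓ` is the leader.
    refine ⟨ℓ + n * (2 * (GST + Δ + 1) + 3), fun q hq t h => ?_⟩
    obtain ⟨r, hr, s, hs⟩ := h.exists_stall_eq hbyz hx hq
    have hle : Fin.ofNat n (ℓ + n * (2 * (GST + Δ + 1) + 3)) = ℓ := by
      ext
      simp [Fin.ofNat, Nat.mod_eq_of_lt ℓ.2]
    rw [hle] at hs
    have h1 := stall_le_of_correct hx hr hℓ s
    have h2 := Nat.le_mul_of_pos_left (2 * (GST + Δ + 1) + 3) (NeZero.pos n)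
    omega
  set e := Nat.find hex with he
  have hnot : ∀ q ∉ byz, ∀ t, ¬ EpochOver (stateAt x q t).seen e := Nat.find_spec hex
  have hover : ∀ e' < e, ∃ T, ∀ q ∉ byz, ∀ t, T ≤ t → EpochOver (stateAt x q t).seen e' := by
    intro e' h
    have h' := Nat.find_min hex h
    push Not at h'
    obtain ⟨q, hq, t, h'⟩ := h'
    exact ⟨t + (GST + Δ + 1), fun r hr u hu => h'.mono (seen_relay hx hq hr hu)⟩
  choose! T hT using hover
  refine ⟨∑ e' ∈ Finset.range e, T e', Fin.ofNat n e, e, ⟨fun p hp t ht => ?_, ?_⟩⟩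
  · have : epoch (stateAt x p t).seen = e := epoch_eq (hnot p hp t) fun e' h =>
      hT e' h p hp t ((Finset.single_le_sum (fun _ _ => Nat.zero_le _)
        (Finset.mem_range.2 h)).trans ht)
    rw [LocalState.shown, this]
  · by_contra! h
    have h1 : ∀ q, q ∉ byz → ∃ s, (stateAt x q s).stall (Fin.ofNat n e) = e := by
      intro q hq
      obtain ⟨t, ht⟩ := h q hq
      exact exists_stall_eq_of_le hx hq ht
    choose! s hs using h1
    obtain ⟨p, hp⟩ := exists_correct hbyz
    -- By the following round `p` has seen the complaints of all correct processes.
    refine hnot p hp (∑ q, (s q + 1) + (GST + Δ + 1)) ?_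
    have hsub : ((byzᶜ : Finset (Fin n)) : Set (Fin n)) ⊆
        {q : Fin n | (⟨q, .stalled (Fin.ofNat n e) e, []⟩ : Stmt n Block) ∈
          (stateAt x p (∑ q, (s q + 1) + (GST + Δ + 1))).seen} := by
      intro q hq
      have hq : q ∉ byz := by simpa using hq
      refine seen_relay hx hq hp (t := s q + 1) ?_
        ((mem_seen_succ hx hq).2 (.inr (.inr (mem_ownStmts.2 (.inr (.inl
          ⟨Fin.ofNat n e, by rw [hs q hq]⟩))))))
      have := Finset.single_le_sum (f := fun q => s q + 1) (fun _ _ => Nat.zero_le _)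
        (Finset.mem_univ q)
      omega
    have := Set.ncard_le_ncard hsub (Set.toFinite _)
    rw [Set.ncard_coe_finset, Finset.card_compl, Fintype.card_fin] at this
    unfold EpochOver
    omega

namespace FinalLeader

variable {T k : ℕ}

theorem not_equivocates (hx : x.IsRun byz GST Δ) (h : FinalLeader x byz T ℓ k) (hp : p ∉ byz)
    (t : ℕ) : ¬ Equivocates (stateAt x p t).seen ℓ := by
  intro he
  obtain ⟨r, hr, hk⟩ := h.content
  refine (exists_le_stall_of_unsatisfactory (ℓ := ℓ) (T := t + (GST + Δ + 1)) hx hr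
    (fun u hu => .inl (he.mono (seen_relay hx hp hr hu))) k).not_gt (hk _)

theorem prefix_or_prefix (hx : x.IsRun byz GST Δ) (h : FinalLeader x byz T ℓ k) (hp : p ∉ byz)
    (hq : q ∉ byz) (t t' : ℕ) : (stateAt x p t).copy ℓ <+: (stateAt x q t').copy ℓ ∨
      (stateAt x q t').copy ℓ <+: (stateAt x p t).copy ℓ := by
  rcases copy_eq_or_prefix (ℓ := ℓ) hx hp t with e | ⟨s, -, m, hm, hl, hpre⟩
  · exact .inl (e ▸ (copy_grown hx hq t').genesis_prefix)
  rcases copy_eq_or_prefix (ℓ := ℓ) hx hq t' with e | ⟨s', -, m', hm', hl', hpre'⟩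
  · exact .inr (e ▸ (copy_grown hx hp t).genesis_prefix)
  by_contra hcon
  refine h.not_equivocates hx hp (s + s' + (GST + Δ + 1)) ⟨m, seen_mono hx hp (by omega) hm, m',
    seen_relay hx hq hp (by omega) hm', hl, hl', fun hmm => ?_, fun hmm => ?_⟩
  · exact hcon (List.prefix_or_prefix_of_prefix (hpre.trans hmm) hpre')
  · exact hcon (List.prefix_or_prefix_of_prefix hpre (hpre'.trans hmm))

theorem prefix_of_length_le (hx : x.IsRun byz GST Δ) (h : FinalLeader x byz T ℓ k) (hp : p ∉ byz)
    (hq : q ∉ byz)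
    (hle : ((stateAt x p t).copy ℓ).length ≤ ((stateAt x q t').copy ℓ).length) :
    (stateAt x p t).copy ℓ <+: (stateAt x q t').copy ℓ := by
  rcases h.prefix_or_prefix hx hp hq t t' with h | h
  · exact h
  · rw [h.eq_of_length_le hle]

/-- The copies of the log of the final leader, at two correct processes, run behind each other by
a bounded time only, since both grow by at most one block per round. -/
theorem copy_prefix_copy_add (hx : x.IsRun byz GST Δ) (h : FinalLeader x byz T ℓ k) (hp : p ∉ byz)
    (hq : q ∉ byz) (t : ℕ) :
    (stateAt x p t).copy ℓ <+: (stateAt x q (t + (GST + Δ + 1))).copy ℓ := by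
  induction t with
  | zero =>
    rw [stateAt_zero hx hp]
    exact (copy_grown hx hq _).genesis_prefix
  | succ t ih =>
    refine h.prefix_of_length_le hx hp hq ?_
    have hle := (copy_mono (ℓ := ℓ) hx hq
      (show t + (GST + Δ + 1) ≤ t + 1 + (GST + Δ + 1) by omega)).length_le
    by_cases hg : CanGrow P ((stateAt x p t).copy ℓ)
      (nextInLog (stateAt x p t).seen ℓ ((stateAt x p t).copy ℓ))
    · obtain ⟨b, ⟨m, hm, hl, hpre⟩, hb, hPb, e⟩ := hg.exists_grow_eq
      rw [copy_succ hx hp, e, List.length_append, List.length_singleton]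
      rcases ih.length_le.lt_or_eq with hlt | heq
      · omega
      · have hc := ih.eq_of_length heq
        have hg' : CanGrow P ((stateAt x q (t + (GST + Δ + 1))).copy ℓ)
            (nextInLog (stateAt x q (t + (GST + Δ + 1))).seen ℓ
              ((stateAt x q (t + (GST + Δ + 1))).copy ℓ)) := by
          rw [← hc]
          exact ⟨b, ⟨m, seen_relay hx hp hq le_rfl hm, hl, hpre⟩, hb, hPb⟩
        obtain ⟨b', -, -, -, e'⟩ := hg'.exists_grow_eq
        rw [show t + 1 + (GST + Δ + 1) = t + (GST + Δ + 1) + 1 by omega, copy_succ hx hq, e',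
          List.length_append, List.length_singleton, heq]
    · rw [copy_succ hx hp, grow_of_not_canGrow hg]
      exact ih.length_le.trans hle

/-- If the copies of the log of the final leader stop growing at `c`, then no block known to a
correct process extends `c`. -/
theorem not_canGrow_of_eventually_eq (hx : x.IsRun byz GST Δ) (h : FinalLeader x byz T ℓ k)
    {c : List Block} {U : ℕ} (hc : ∀ p ∉ byz, ∀ t, U ≤ t → (stateAt x p t).copy ℓ = c)
    (hp : p ∉ byz) (t : ℕ) : ¬ CanGrow P c (carried (stateAt x p t).seen) := by
  intro hg
  obtain ⟨r, hr, hk⟩ := h.content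
  refine (exists_le_stall_of_unsatisfactory (ℓ := ℓ) (T := U + t + (GST + Δ + 1)) hx hr
    (fun u hu => .inr ⟨fun hg' => ?_, ?_⟩) k).not_gt (hk _)
  · obtain ⟨b, -, -, -, e⟩ := hg'.exists_grow_eq
    rw [← copy_succ hx hr, hc r hr _ (by omega), hc r hr _ (by omega)] at e
    simpa using congrArg List.length e
  · rw [hc r hr u (by omega)]
    exact hg.mono (carried_mono (seen_relay hx hp hr (by omega)))

end FinalLeader

/-! ### The history of an execution -/

theorem answer_append (x : BTExecution (followLeader b₀ P n)) (p : Fin n) (t : ℕ) (b : Block) :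
    (followLeader b₀ P n).answer p (x.state p t) (.append b) = some (.appendRsp b true) :=
  rfl

theorem answer_read (x : BTExecution (followLeader b₀ P n)) (p : Fin n) (t : ℕ) :
    (followLeader b₀ P n).answer p (x.state p t) .read =
      some (.readRsp (stateAt x p t).shown) :=
  rfl

theorem not_isInv_of_answer {o : BTOp Block} {l : BTLabel Block}
    (h : (followLeader b₀ P n).answer p (x.state p t) o = some l) : ¬ l.isInv := by
  cases o
  · rw [answer_append, Option.some.injEq] at h
    subst h
    exact id
  · rw [answer_read, Option.some.injEq] at h
    subst h
    exact id

theorem busy_eq_none (x : BTExecution (followLeader b₀ P n)) (p : Fin n) (t : ℕ) :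
    x.busy p t = none := by
  cases t with
  | zero => rfl
  | succ t =>
    rw [BTExecution.busy, Option.filter_eq_none_iff]
    rintro (_ | _) - <;> simp [BTProtocol.answer, followLeader]

theorem invoked_eq (x : BTExecution (followLeader b₀ P n)) (p : Fin n) (t : ℕ) :
    x.invoked p t = x.request p t := by
  simp [BTExecution.invoked, busy_eq_none]

theorem current_eq (x : BTExecution (followLeader b₀ P n)) (p : Fin n) (t : ℕ) :
    x.current p t = x.request p t := by
  simp [BTExecution.current, busy_eq_none]

theorem terminating_history (x : BTExecution (followLeader b₀ P n)) (byz : Finset (Fin n)) :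
    (x.history byz).Terminating := by
  rintro ⟨p, t, l⟩ he hp hinv
  rcases he with ⟨-, o, ho, rfl⟩ | ⟨-, o, -, ho⟩ | ⟨hp', -⟩
  · rw [invoked_eq, ← current_eq] at ho
    cases o with
    | append b =>
      exact ⟨⟨p, t, .appendRsp b true⟩, .inr (.inl ⟨hp, _, ho, answer_append x p (t + 1) b⟩),
        ⟨rfl, .inr ⟨rfl, hinv, trivial⟩⟩, rfl⟩
    | read =>
      exact ⟨⟨p, t, .readRsp (stateAt x p (t + 1)).shown⟩,
        .inr (.inl ⟨hp, _, ho, answer_read x p (t + 1)⟩),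
        ⟨rfl, .inr ⟨rfl, hinv, trivial⟩⟩, trivial⟩
  · exact absurd hinv (not_isInv_of_answer ho)
  · exact absurd hp' hp

theorem correct_and_eq_shown_of_isRead {e : BTEvent n Block} {bc : List Block} (h : (x.history byz).IsRead e bc) :
    e.proc ∉ byz ∧ bc = (stateAt x e.proc (e.time + 1)).shown := by
  obtain ⟨h, hl⟩ := h
  rcases h with ⟨-, o, -, ho⟩ | ⟨hp, o, -, ho⟩ | ⟨-, b, q, m, -, -, ho⟩
  · cases o <;> rw [hl] at ho <;> cases ho
  · refine ⟨hp, ?_⟩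
    cases o <;> rw [hl] at ho
    · cases ho
    · simp only [BTProtocol.answer, followLeader, Option.map_some, Option.some.injEq,
        BTLabel.readRsp.injEq] at ho
      exact ho.symm
  · rw [hl] at ho; cases ho

theorem appended_of_isAppend {e : BTEvent n Block} {b : Block} (hx : x.IsRun byz GST Δ)
    (hp : e.proc ∉ byz) (h : (x.history byz).IsAppend e b) :
    b ∈ carried (stateAt x e.proc (e.time + 1)).seen := by
  obtain ⟨h, hl⟩ := h
  rcases h with ⟨-, o, hi, ho⟩ | ⟨-, o, -, ho⟩ | ⟨hp', -⟩
  · cases o <;> rw [hl] at ho <;> cases ho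
    exact ⟨⟨e.proc, .appended, [b]⟩, (mem_seen_succ hx hp).2
      (.inr (.inr (mem_ownStmts.2 (.inr (.inr ⟨b, hi, rfl⟩))))), by simp⟩
  · cases o <;> rw [hl] at ho <;> cases ho
  · exact absurd hp' hp

theorem mem_log (hx : x.IsRun byz GST Δ) (hp : p ∉ byz) {b : Block}
    (hb : b ∈ (stateAt x p t).log) : b = b₀ ∨ b ∈ carried (stateAt x p t).seen := by
  induction t with
  | zero => rw [stateAt_zero hx hp] at hb; exact .inl (by simpa using hb)
  | succ t ih =>
    have hmono := carried_mono (seen_mono hx hp t.le_succ)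
    rw [log_succ hx hp] at hb
    by_cases hg : CanGrow P (stateAt x p t).log (carried (stateAt x p t).seen)
    · obtain ⟨b', hb', -, -, e⟩ := hg.exists_grow_eq
      rw [e, List.mem_append, List.mem_singleton] at hb
      rcases hb with hb | rfl
      · exact (ih hb).imp_right (@hmono _)
      · exact .inr (hmono hb')
    · rw [grow_of_not_canGrow hg] at hb
      exact (ih hb).imp_right (@hmono _)

theorem exists_isAppend_of_carried (hx : x.IsRun byz GST Δ) (hp : p ∉ byz) {b : Block}
    (hb : b ∈ carried (stateAt x p t).seen) (hb₀ : b ≠ b₀) :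
    ∃ a, (x.history byz).IsAppend a b ∧ a.time < t := by
  induction t using Nat.strong_induction_on generalizing p with
  | _ t ih =>
    obtain ⟨m, hm, hbm⟩ := hb
    cases t with
    | zero => rw [stateAt_zero hx hp] at hm; simp at hm
    | succ t =>
      rcases (mem_seen_succ hx hp).1 hm with h | ⟨r, s, hst, h⟩ | h
      · obtain ⟨a, ha, hlt⟩ := ih t t.lt_succ_self hp ⟨m, h, hbm⟩
        exact ⟨a, ha, by omega⟩
      · have hlt := hx.causal r s p
        by_cases hr : r ∈ byz
        · exact ⟨⟨r, s, .appendInv b⟩, ⟨.inr (.inr ⟨hr, b, p, m, h, hbm, rfl⟩), rfl⟩,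
            show s < t + 1 by omega⟩
        · obtain ⟨a, ha, hlt'⟩ := ih (s + 1) (by omega) hr ⟨m, seen_of_sent hx hr h, hbm⟩
          exact ⟨a, ha, by omega⟩
      · rcases mem_ownStmts.1 h with rfl | ⟨_, rfl⟩ | ⟨b', hi, rfl⟩
        · obtain ⟨a, ha, hlt⟩ := ih t t.lt_succ_self hp ((mem_log hx hp hbm).resolve_left hb₀)
          exact ⟨a, ha, by omega⟩
        · simp at hbm
        · obtain rfl : b = b' := by simpa using hbm
          exact ⟨⟨p, t, .appendInv b⟩, ⟨.inl ⟨hp, _, hi, rfl⟩, rfl⟩, t.lt_succ_self⟩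

theorem finite_early_reads (x : BTExecution (followLeader b₀ P n)) (byz : Finset (Fin n)) (T : ℕ) :
    {e | (∃ bc, (x.history byz).IsRead e bc) ∧ e.time < T}.Finite := by
  refine (((Set.finite_univ (α := Fin n)).prod (Set.finite_Iio T)).image
    fun a => ⟨a.1, a.2, .readRsp (stateAt x a.1 (a.2 + 1)).shown⟩).subset ?_
  rintro ⟨p, t, l⟩ ⟨⟨bc, h⟩, ht⟩
  have hl : l = .readRsp bc := h.2
  obtain ⟨-, e⟩ := correct_and_eq_shown_of_isRead h
  exact ⟨(p, t), ⟨trivial, ht⟩, by rw [hl, e]⟩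

theorem exists_late_read (h : (x.history byz).InfReads) (T : ℕ) :
    ∃ e bc, (x.history byz).IsRead e bc ∧ T ≤ e.time := by
  by_contra! hlt
  exact h ((finite_early_reads x byz T).subset fun e ⟨bc, he⟩ => ⟨⟨bc, he⟩, hlt e bc he⟩)

/-! ### The consistency criteria -/

theorem chainValidity_history (hP : P [b₀]) (hx : x.IsRun byz GST Δ) :
    (x.history byz).ChainValidity b₀ P := by
  intro r bc h
  obtain ⟨hp, rfl⟩ := correct_and_eq_shown_of_isRead h
  have hg : Grown b₀ P (stateAt x r.proc (r.time + 1)).shown := copy_grown hx hp _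
  exact ⟨hg.head?_eq, hg.nodup, hg.valid hP⟩

theorem chainIntegrity_history (hx : x.IsRun byz GST Δ) : (x.history byz).ChainIntegrity b₀ := by
  intro r bc h b hb hb₀
  obtain ⟨hp, rfl⟩ := correct_and_eq_shown_of_isRead h
  rcases copy_eq_or_prefix hx hp (r.time + 1) with e | ⟨s, hs, m, hm, -, hpre⟩
  · rw [LocalState.shown, e] at hb
    exact absurd (by simpa using hb) hb₀
  · obtain ⟨a, ha, hlt⟩ := exists_isAppend_of_carried hx hp ⟨m, hm, hpre.subset hb⟩ hb₀
    exact ⟨a, ha, by omega⟩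

namespace FinalLeader

variable {T k : ℕ}

theorem eq_copy_of_isRead (h : FinalLeader x byz T ℓ k) {e : BTEvent n Block} {bc : List Block}
    (hr : (x.history byz).IsRead e bc) (ht : T ≤ e.time) :
    e.proc ∉ byz ∧ bc = (stateAt x e.proc (e.time + 1)).copy ℓ := by
  obtain ⟨hp, rfl⟩ := correct_and_eq_shown_of_isRead hr
  exact ⟨hp, h.shown _ hp _ (by omega)⟩

theorem eventualStrongPrefix (hx : x.IsRun byz GST Δ) (h : FinalLeader x byz T ℓ k) :
    (x.history byz).EventualStrongPrefix := by
  intro hinf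
  obtain ⟨r, bc, hr, ht⟩ := exists_late_read hinf T
  refine ⟨r, bc, hr, fun r' bc' r'' bc'' hr' hr'' ho' ho'' => ?_⟩
  obtain ⟨hp', rfl⟩ := h.eq_copy_of_isRead hr' (ht.trans (time_le_of_progOrder ho'))
  obtain ⟨hp'', rfl⟩ := h.eq_copy_of_isRead hr'' (ht.trans (time_le_of_progOrder ho''))
  exact h.prefix_or_prefix hx hp'' hp' _ _

theorem boundedDisplacement (hx : x.IsRun byz GST Δ) (h : FinalLeader x byz T ℓ k) :
    (x.history byz).BoundedDisplacement := by
  -- `T + 1` is at least the length of the chains read before round `T`; by `GST + Δ + 1` rounds,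
  -- hence by as many blocks, one process may run behind another one later.
  refine ⟨(T + 1) + (GST + Δ + 1), fun r bc r' bc' hr hr' ho i hi => ?_⟩
  have hle := time_le_of_progOrder ho
  rcases lt_or_ge r.time T with ht | ht
  · obtain ⟨hp, rfl⟩ := correct_and_eq_shown_of_isRead hr
    have := length_copy_le (ℓ := Fin.ofNat n (epoch (stateAt x r.proc (r.time + 1)).seen)) hx hp
      (r.time + 1)
    unfold LocalState.shown at hi
    omega
  · obtain ⟨hp, rfl⟩ := h.eq_copy_of_isRead hr ht
    obtain ⟨hp', rfl⟩ := h.eq_copy_of_isRead hr' (ht.trans hle)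
    have h1 := (h.copy_prefix_copy_add hx hp hp' (r.time + 1)).length_le
    have h2 := length_copy_add_le (ℓ := ℓ) hx hp' (r.time + 1) (GST + Δ + 1)
    have h3 := (copy_mono (ℓ := ℓ) hx hp' (Nat.succ_le_succ hle)).length_le
    have hi' : i < ((stateAt x r'.proc (r'.time + 1)).copy ℓ).length := by
      simp only [Nat.succ_eq_add_one] at h3
      omega
    rcases h.prefix_or_prefix hx hp hp' (r.time + 1) (r'.time + 1) with hpre | hpre
    · rw [List.prefix_iff_getElem?] at hpre
      rw [hpre i (by omega), List.getElem?_eq_getElem]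
    · rw [List.prefix_iff_getElem?] at hpre
      rw [hpre i hi', List.getElem?_eq_getElem]

theorem eventualPrefix (hx : x.IsRun byz GST Δ) (h : FinalLeader x byz T ℓ k) :
    (x.history byz).EventualPrefix := by
  intro hinf _ _ _ i _
  by_cases hlong : ∃ p ∉ byz, ∃ t, i < ((stateAt x p t).copy ℓ).length
  · obtain ⟨p, hp, t, hi⟩ := hlong
    obtain ⟨r, bc, hr, ht⟩ := exists_late_read hinf (T + t + (GST + Δ + 1))
    have key : ∀ r' bc', (x.history byz).IsRead r' bc' → r.time ≤ r'.time →
        bc'[i]? = some ((stateAt x p t).copy ℓ)[i] := by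
      intro r' bc' hr' hle
      obtain ⟨hp', rfl⟩ := h.eq_copy_of_isRead hr' (by omega)
      exact List.prefix_iff_getElem?.1 ((h.copy_prefix_copy_add hx hp hp' t).trans
        (copy_mono hx hp' (by omega))) i hi
    exact ⟨r, bc, hr, fun r' bc' hr' ho => by
      rw [key r bc hr le_rfl, key r' bc' hr' (time_le_of_progOrder ho)]⟩
  · push Not at hlong
    obtain ⟨r, bc, hr, ht⟩ := exists_late_read hinf T
    have key : ∀ r' bc', (x.history byz).IsRead r' bc' → r.time ≤ r'.time → bc'[i]? = none := by
      intro r' bc' hr' hle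
      obtain ⟨hp', rfl⟩ := h.eq_copy_of_isRead hr' (by omega)
      exact List.getElem?_eq_none (hlong _ hp' _)
    exact ⟨r, bc, hr, fun r' bc' hr' ho => by
      rw [key r bc hr le_rfl, key r' bc' hr' (time_le_of_progOrder ho)]⟩

theorem everGrowingTree (hbyz : 2 * byz.card < n) (hx : x.IsRun byz GST Δ)
    (h : FinalLeader x byz T ℓ k) : (x.history byz).EverGrowingTree P := by
  intro hinf _ hext K
  by_contra! hshort
  have hbound : ∀ p ∉ byz, ∀ t, ((stateAt x p t).copy ℓ).length ≤ K := by
    intro p hp t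
    obtain ⟨r, bc, hr, ht⟩ := exists_late_read hinf (T + t + (GST + Δ + 1))
    have hK := hshort r bc hr
    obtain ⟨hp', rfl⟩ := h.eq_copy_of_isRead hr (by omega)
    exact ((h.copy_prefix_copy_add hx hp hp' t).trans
      (copy_mono hx hp' (by omega))).length_le.trans hK
  -- A longest copy `c` that ever occurs is in the end the copy of every correct process.
  obtain ⟨p, hp, t, hmax⟩ : ∃ p ∉ byz, ∃ t, ∀ q ∉ byz, ∀ u,
      ((stateAt x q u).copy ℓ).length ≤ ((stateAt x p t).copy ℓ).length := by
    obtain ⟨p₀, hp₀⟩ := exists_correct hbyz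
    let L : Set ℕ := {j | ∃ p ∉ byz, ∃ t, ((stateAt x p t).copy ℓ).length = j}
    have hne : L.Nonempty := ⟨_, p₀, hp₀, 0, rfl⟩
    have hbdd : BddAbove L := ⟨K, fun _ ⟨p, hp, t, e⟩ => e ▸ hbound p hp t⟩
    obtain ⟨p, hp, t, e⟩ := Nat.sSup_mem hne hbdd
    exact ⟨p, hp, t, fun q hq u => e ▸ le_csSup hbdd ⟨q, hq, u, rfl⟩⟩
  have hc : ∀ q ∉ byz, ∀ u, t + (GST + Δ + 1) ≤ u →
      (stateAt x q u).copy ℓ = (stateAt x p t).copy ℓ := fun q hq u hu =>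
    (((h.copy_prefix_copy_add hx hp hq t).trans (copy_mono hx hq hu)).eq_of_length_le
      (hmax q hq u)).symm
  have hfin : {e | ∃ bc, (x.history byz).IsRead e bc ∧ bc ≠ (stateAt x p t).copy ℓ}.Finite := by
    refine (finite_early_reads x byz (T + t + (GST + Δ + 1))).subset ?_
    rintro e ⟨bc, hr, hne⟩
    refine ⟨⟨bc, hr⟩, ?_⟩
    by_contra! hle
    obtain ⟨hp', rfl⟩ := h.eq_copy_of_isRead hr (by omega)
    exact hne (hc _ hp' _ (by omega))
  obtain ⟨e, he, b, ha, hb, hPb⟩ := (hext _ hfin).nonempty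
  exact h.not_canGrow_of_eventually_eq hx hc he (e.time + 1)
    ⟨b, appended_of_isAppend hx he ha, hb, hPb⟩

end FinalLeader

end Run

/-- For every number of processes, genesis block and validity predicate there is a protocol all of
whose eventually synchronous executions with a majority of correct processes (the Byzantine
processes, the stabilisation time and the message delay being unknown to the protocol) satisfy
unknown bounded displacement eventual prefix consistency and eventual strong prefix consistency. -/
theorem mainTheorem7 {Block : Type} (b₀ : Block) (P : List Block → Prop) (hP : P [b₀]) (n : ℕ) :
    ∃ A : BTProtocol n Block,
      ∀ byz : Finset (Fin n), 2 * byz.card < n →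
      ∀ (GST Δ : ℕ) (x : BTExecution A), x.IsRun byz GST Δ →
        (x.history byz).Terminating ∧
        (x.history byz).UBDEP b₀ P ∧
        (x.history byz).ESP b₀ P := by
  rcases Nat.eq_zero_or_pos n with rfl | hn
  · -- Without processes the hypothesis on the number of Byzantine processes fails.
    exact ⟨⟨Unit, Unit, fun _ => (), fun _ _ _ _ => (), fun _ _ _ => ∅, fun _ _ _ => none,
      fun _ _ => none⟩, fun _ h => absurd h (Nat.not_lt_zero _)⟩
  have : NeZero n := ⟨hn.ne'⟩
  refine ⟨followLeader b₀ P n, fun byz hbyz GST Δ x hx => ?_⟩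
  obtain ⟨T, ℓ, k, h⟩ := exists_finalLeader hbyz hx
  have hv := chainValidity_history hP hx
  have hi := chainIntegrity_history hx
  have hg := h.everGrowingTree hbyz hx
  exact ⟨terminating_history x byz,
    ⟨⟨hv, hi, h.eventualPrefix hx, hg⟩, h.boundedDisplacement hx⟩,
    ⟨hv, hi, h.eventualStrongPrefix hx, hg⟩⟩
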